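/- Let $\kappa$ be an uncountable regular cardinal. Then the following statements are equivalent: 1. $\kappa$ is weakly compact. 2. Every partial order of cardinality at most $\kappa$ that satisfies the $\kappa$-chain condition is $\kappa$-stationarily layered. 3. Every partial order that satisfies the $\kappa$-chain condition is $\kappa$-stationarily layered. Here $\kappa$ is *weakly compact* if it is uncountable and $\kappa\to(\kappa)^2_2$ holds, i.e. for every colouring of the two-element subsets of a set of size $\kappa$ with two colours there is a homogeneous subset of size $\kappa$. Two conditions $p,q$ of a partial order $\mathbb{P}$ are *compatible* if there is $r\in\mathbb{P}$ with $r\le p$ and $r\le q$; an *antichain* is a set of pairwise incompatible conditions, and $\mathbb{P}$ satisfies the *$\kappa$-chain condition* if every antichain in $\mathbb{P}$ has cardinality less than $\kappa$. A subset $\mathbb{Q}\subseteq\mathbb{P}$ with the induced order is a *regular suborder* of $\mathbb{P}$ if conditions that are incompatible in $\mathbb{Q}$ are incompatible in $\mathbb{P}$ and every maximal antichain in $\mathbb{Q}$ is a maximal antichain in $\mathbb{P}$. For a set $A$, let $\mathcal{P}_\kappa(A)$ denote the collection of all subsets of $A$ of cardinality less than $\kappa$; a subset of $\mathcal{P}_\kappa(A)$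 is *club* if it is cofinal in $(\mathcal{P}_\kappa(A),\subseteq)$ and contains the union of each nonempty $\subseteq$-chain of fewer than $\kappa$ of its members, and a subset of $\mathcal{P}_\kappa(A)$ is *stationary* if it meets every club. Finally, $\mathbb{P}$ is *$\kappa$-stationarily layered* if the collection of all regular suborders of $\mathbb{P}$ of cardinality less than $\kappa$ is stationary in $\mathcal{P}_\kappa(\mathbb{P})$. -/

import Mathlib

open Cardinal

universe u

namespace Layered

/-- `κ` is weakly compact: `κ` is uncountable and `κ → (κ)²₂`, i.e. every colouring of the
two-element subsets of a set of size `κ` with two colours has a homogeneous set of size `κ`.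
(A colouring is given on unordered pairs; its values at the degenerate pairs `s(x, x)` play no
role.) -/
def IsWeaklyCompact (κ : Cardinal.{u}) : Prop :=
  ℵ₀ < κ ∧ ∀ A : Type u, #A = κ → ∀ c : Sym2 A → Bool,
    ∃ H : Set A, #H = κ ∧ ∃ i : Bool, ∀ x ∈ H, ∀ y ∈ H, x ≠ y → c s(x, y) = i

/-- Two conditions are compatible if they have a common extension (stronger = smaller). -/
def Compat {P : Type u} [PartialOrder P] (p q : P) : Prop :=
  ∃ r, r ≤ p ∧ r ≤ q

/-- The `κ`-chain condition: every antichain (set of pairwise incompatible conditions) has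
cardinality less than `κ`.  `IsAntichain Compat A` says that distinct elements of `A` are not
related by `Compat`. -/
def ChainCondition (κ : Cardinal.{u}) (P : Type u) [PartialOrder P] : Prop :=
  ∀ A : Set P, IsAntichain Compat A → #A < κ

/-- `Q ⊆ P`, with the induced order, is a regular suborder of `P`: the inclusion preserves
incompatibility, and every maximal antichain in `Q` is a maximal antichain in `P`. -/
structure IsRegularSuborder {P : Type u} [PartialOrder P] (Q : Set P) : Prop where
  incompat : ∀ p q : Q, ¬ Compat p q → ¬ Compat (p : P) (q : P)
  maxAntichain : ∀ A : Set Q, IsMaxAntichain Compat A →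
    IsMaxAntichain Compat ((fun q : Q => (q : P)) '' A)

/-- `𝒫_κ(A)`: the collection of all subsets of `A` of cardinality less than `κ`. -/
def PKappa (κ : Cardinal.{u}) (A : Type u) : Set (Set A) :=
  {a | #a < κ}

/-- `Reg_κ(P)`: the collection of all regular suborders of `P` of cardinality less than `κ`. -/
def Reg (κ : Cardinal.{u}) (P : Type u) [PartialOrder P] : Set (Set P) :=
  {Q | Q ∈ PKappa κ P ∧ IsRegularSuborder Q}

/-- `C` is club in `𝒫_κ(A)`: it is a cofinal subset of `𝒫_κ(A)`, and it is closed under unions of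
nonempty `⊆`-chains with fewer than `κ` members. -/
structure IsClubPKappa (κ : Cardinal.{u}) {A : Type u} (C : Set (Set A)) : Prop where
  subset : C ⊆ PKappa κ A
  cofinal : ∀ a ∈ PKappa κ A, ∃ c ∈ C, a ⊆ c
  closed : ∀ D : Set (Set A), D ⊆ C → D.Nonempty → IsChain (· ⊆ ·) D → #D < κ → ⋃₀ D ∈ C

/-- Jech's notion of stationarity: `S ⊆ 𝒫_κ(A)` meets every club in `𝒫_κ(A)`. -/
def IsStationaryPKappa (κ : Cardinal.{u}) {A : Type u} (S : Set (Set A)) : Prop :=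
  S ⊆ PKappa κ A ∧ ∀ C : Set (Set A), IsClubPKappa κ C → (S ∩ C).Nonempty

/-- `P` is `κ`-stationarily layered: `Reg_κ(P)` is stationary in `𝒫_κ(P)`. -/
def StationarilyLayered (κ : Cardinal.{u}) (P : Type u) [PartialOrder P] : Prop :=
  IsStationaryPKappa κ (Reg κ P)

end Layered

/-! Weak compactness implies layering: suppose a club has no regular member. Build an increasing
chain `Q a` in it, with `R a` the union of the earlier stages. Either `R a` lacks a common extension
of a compatible pair from `R a`, or some antichain `A (R a)`, predense in `R a`, misses a condition
`b (R a)`. Stage `Q a` contains the absent extensions and `b (R a)`. Weak compactness gives a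
`κ`-complete filter making the relevant regressive functions constant
(`exists_normal_filter_of_filtration`). A constant bad pair is refuted at a later stage. Otherwise,
the conditions lying in almost every `A (R a)` form an antichain, small by the chain condition,
hence contained in a single `A (R a)`. One of them is compatible with `b (R a)`, a contradiction.

Layering implies weak compactness: a chain of size `κ` in the Erdős–Rado tree of a colouring yields
a homogeneous set. Without such chains, the finite antichains of the tree satisfy the `κ`-chain
condition (`exists_compatible_pair`). Layering then makes the conditions supported below some `l` at
a limit of the tree a regular suborder. But the singletons of predecessors of `l` form a maximal
antichain there, and `{l}` is incompatible with all of them (`not_isRegularSuborder_Iio`). -/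

namespace Layered

open Set Filter

/-! ### Well-orders of type `κ`. -/

/-- `I` is a well-order of type `κ`, for `κ` regular: it has cardinality `κ`, its initial segments
are smaller than `κ`, and sets smaller than `κ` are strictly bounded. -/
structure IsInitialOrder (κ : Cardinal.{u}) (I : Type u) [LinearOrder I] : Prop where
  mk_eq : #I = κ
  mk_Iic_lt : ∀ a : I, #(Iic a) < κ
  exists_gt : ∀ s : Set I, #s < κ → ∃ b, ∀ a ∈ s, a < b

theorem isInitialOrder_toType {κ : Cardinal.{u}} (hreg : κ.IsRegular) :
    IsInitialOrder κ κ.ord.ToType where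
  mk_eq := by simp
  mk_Iic_lt a := by
    have := Cardinal.noMaxOrder hreg.aleph0_le
    obtain ⟨b, hb⟩ := exists_gt a
    have h1 : #(Iio b) < #κ.ord.ToType := mk_Iio_lt b (by simp)
    rw [mk_ord_toType] at h1
    exact (mk_le_mk_of_subset fun x hx => lt_of_le_of_lt hx hb).trans_lt h1
  exists_gt s hs := by
    by_contra! hcon
    have h1 : IsCofinal s := hcon
    have := Order.cof_le h1
    rw [Ordinal.cof_toType, hreg.cof_ord] at this
    exact this.not_gt hs

namespace IsInitialOrder

variable {κ : Cardinal.{u}} {I : Type u} [LinearOrder I]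

theorem exists_mem_gt (h : IsInitialOrder κ I) {s : Set I} (hs : #s = κ) (a : I) :
    ∃ x ∈ s, a < x := by
  by_contra! hcon
  exact ((mk_le_mk_of_subset (show s ⊆ Iic a from hcon)).trans_lt (h.mk_Iic_lt a)).ne hs

theorem nonempty (h : IsInitialOrder κ I) (hκ : ℵ₀ ≤ κ) : Nonempty I := by
  rw [← mk_ne_zero_iff, h.mk_eq]
  exact (aleph0_pos.trans_le hκ).ne'

theorem cardinalInterFilter_atTop (h : IsInitialOrder κ I) (hκ : ℵ₀ ≤ κ) :
    CardinalInterFilter (atTop : Filter I) κ where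
  cardinal_sInter_mem S hS hmem := by
    have := h.nonempty hκ
    choose! a ha using fun s (hs : s ∈ S) => mem_atTop_sets.1 (hmem s hs)
    obtain ⟨b, hb⟩ := h.exists_gt (a '' S) (mk_image_le.trans_lt hS)
    exact mem_atTop_sets.2 ⟨b, fun x hx s hs =>
      ha s hs x ((hb _ (mem_image_of_mem a hs)).le.trans hx)⟩

end IsInitialOrder

/-! ### Normal filters from weak compactness. -/

section Filters

variable {κ : Cardinal.{u}} {I : Type u} [LinearOrder I]

/-- Weak compactness yields a homogeneous set for the lexicographic order of a sequence of subsets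
of `I`. -/
theorem exists_lex_homogeneous (hwc : IsWeaklyCompact κ) (h : IsInitialOrder κ I)
    (X : I → Set I) : ∃ H : Set I, #H = κ ∧
      ∀ ξ, (∀ a ∈ H, ∀ b ∈ H, a < b → (∀ η < ξ, a ∈ X η ↔ b ∈ X η) → a ∈ X ξ → b ∈ X ξ) ∨
        (∀ a ∈ H, ∀ b ∈ H, a < b → (∀ η < ξ, a ∈ X η ↔ b ∈ X η) → b ∈ X ξ → a ∈ X ξ) := by
  classical
  -- Lexicographic comparison of membership sequences: a first difference, if any, goes from
  -- non-member to member.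
  let r : I → I → Prop := fun a b => ∀ ξ, (∀ η < ξ, a ∈ X η ↔ b ∈ X η) → a ∈ X ξ → b ∈ X ξ
  have hr : ∀ a b, ¬ r a b → r b a := by
    intro a b hab ξ' h1 h2
    simp only [r, not_forall] at hab
    obtain ⟨ξ, h3, h4, h5⟩ := hab
    rcases lt_trichotomy ξ ξ' with hlt | rfl | hlt
    · exact absurd ((h1 ξ hlt).2 h4) h5
    · exact h4
    · exact (h3 ξ' hlt).2 h2
  let c : Sym2 I → Bool := fun s => decide (r s.inf s.sup)
  obtain ⟨H, hH, i, hi⟩ := hwc.2 I h.mk_eq c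
  refine ⟨H, hH, fun ξ => ?_⟩
  cases i with
  | true =>
    left
    intro a ha b hb hab
    have := hi a ha b hb hab.ne
    simp only [c, Sym2.inf_mk, Sym2.sup_mk, inf_eq_left.2 hab.le, sup_eq_right.2 hab.le,
      decide_eq_true_eq] at this
    exact this ξ
  | false =>
    right
    intro a ha b hb hab h1
    have := hi a ha b hb hab.ne
    simp only [c, Sym2.inf_mk, Sym2.sup_mk, inf_eq_left.2 hab.le, sup_eq_right.2 hab.le,
      decide_eq_false_iff_not] at this
    exact hr a b this ξ fun η hη => (h1 η hη).symm

variable [WellFoundedLT I]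

/-- The filter is generated by the tails of a lexicographically homogeneous `H`. Once membership in
all earlier sets has stabilised along `H`, membership in `X ξ` is monotone along `H`, hence
eventually constant. -/
theorem exists_deciding_filter (hwc : IsWeaklyCompact κ) (h : IsInitialOrder κ I)
    (𝒳 : Set (Set I)) (h𝒳 : #𝒳 ≤ κ) : ∃ V : Filter I, V.NeBot ∧ V ≤ atTop ∧
      CardinalInterFilter V κ ∧ ∀ s ∈ 𝒳, s ∈ V ∨ sᶜ ∈ V := by
  have hκ : ℵ₀ ≤ κ := hwc.1.le
  have := h.nonempty hκ
  obtain ⟨X, hX⟩ : ∃ X : I → Set I, 𝒳 ⊆ range X := by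
    rcases 𝒳.eq_empty_or_nonempty with rfl | hne
    · exact ⟨fun _ => ∅, empty_subset _⟩
    · have := hne.to_subtype
      rw [← h.mk_eq] at h𝒳
      obtain ⟨e⟩ := h𝒳
      refine ⟨fun i => (Function.invFun e i : 𝒳), fun s hs => ⟨e ⟨s, hs⟩, ?_⟩⟩
      exact congrArg Subtype.val (Function.leftInverse_invFun e.injective ⟨s, hs⟩)
  obtain ⟨H, hH, hlex⟩ := exists_lex_homogeneous hwc h X
  have hc := h.cardinalInterFilter_atTop hκ
  let V : Filter I := atTop ⊓ 𝓟 H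
  have hV : CardinalInterFilter V κ := inferInstance
  have hbasis : ∀ p : I → Prop, (∀ᶠ x in V, p x) ↔ ∃ a, ∀ x ∈ H, a ≤ x → p x := by
    intro p
    simp only [V, eventually_inf_principal, eventually_atTop]
    exact ⟨fun ⟨a, ha⟩ => ⟨a, fun x hx hax => ha x hax hx⟩,
      fun ⟨a, ha⟩ => ⟨a, fun x hax hx => ha x hx hax⟩⟩
  have hne : V.NeBot := by
    refine ⟨fun hbot => ?_⟩
    obtain ⟨a, ha⟩ := (hbasis fun _ => False).1 (by simp [hbot])
    obtain ⟨x, hx, hax⟩ := h.exists_mem_gt hH a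
    exact ha x hx hax.le
  refine ⟨V, hne, inf_le_left, hV, ?_⟩
  suffices ∀ ξ, X ξ ∈ V ∨ (X ξ)ᶜ ∈ V by
    intro s hs
    obtain ⟨ξ, rfl⟩ := hX hs
    exact this ξ
  intro ξ
  induction ξ using WellFoundedLT.induction with
  | ind ξ ih =>
    have hagree : ∀ᶠ a in V, ∀ η ∈ Iio ξ, (a ∈ X η ↔ X η ∈ V) := by
      refine (eventually_cardinal_ball
        ((mk_le_mk_of_subset Iio_subset_Iic_self).trans_lt (h.mk_Iic_lt ξ))).2 fun η hη => ?_
      rcases ih η hη with h1 | h1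
      · filter_upwards [h1] with a ha using iff_of_true ha h1
      · filter_upwards [h1] with a ha
        exact iff_of_false ha fun h2 => compl_notMem h2 h1
    obtain ⟨d, hd⟩ := (hbasis _).1 hagree
    have hd' : ∀ a ∈ H, ∀ b ∈ H, d ≤ a → d ≤ b → ∀ η < ξ, (a ∈ X η ↔ b ∈ X η) :=
      fun a ha b hb hda hdb η hη => (hd a ha hda η hη).trans (hd b hb hdb η hη).symm
    rcases hlex ξ with hm | hm
    · by_cases hex : ∃ a ∈ H, d ≤ a ∧ a ∈ X ξ
      · obtain ⟨a, ha, hda, hax⟩ := hex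
        refine Or.inl ((hbasis _).2 ⟨a, fun b hb hab => ?_⟩)
        rcases hab.eq_or_lt with rfl | hab
        · exact hax
        · exact hm a ha b hb hab (hd' a ha b hb hda (hda.trans hab.le)) hax
      · push Not at hex
        exact Or.inr ((hbasis _).2 ⟨d, hex⟩)
    · by_cases hex : ∃ a ∈ H, d ≤ a ∧ a ∉ X ξ
      · obtain ⟨a, ha, hda, hax⟩ := hex
        refine Or.inr ((hbasis _).2 ⟨a, fun b hb hab => ?_⟩)
        rcases hab.eq_or_lt with rfl | hab
        · exact hax
        · exact fun hbx => hax (hm a ha b hb hab (hd' a ha b hb hda (hda.trans hab.le)) hbx)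
      · push Not at hex
        exact Or.inl ((hbasis _).2 ⟨d, hex⟩)

/-- A weakly compact cardinal carries, for any `κ` many sets and functions, a `κ`-complete filter
which decides the given sets and is normal with respect to the given functions. -/
theorem exists_normal_filter (hwc : IsWeaklyCompact κ) (h : IsInitialOrder κ I)
    (𝒳 : Set (Set I)) (h𝒳 : #𝒳 ≤ κ) (G : Set (I → I)) (hG : #G ≤ κ) :
    ∃ V : Filter I, V.NeBot ∧ V ≤ atTop ∧ CardinalInterFilter V κ ∧
      (∀ s ∈ 𝒳, s ∈ V ∨ sᶜ ∈ V) ∧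
      ∀ g ∈ G, (∀ᶠ a in V, g a < a) → ∃ b, ∀ᶠ a in V, g a = b := by
  have hκ : ℵ₀ ≤ κ := hwc.1.le
  have hI := h.nonempty hκ
  let word : List G → I → I := fun l => l.foldr (fun g f => g.1 ∘ f) id
  have hw : #(List G) ≤ κ := (mk_list_le_max G).trans (max_le hκ hG)
  have hww : ∀ A B : Type u, #A ≤ κ → #B ≤ κ → #(A × B) ≤ κ := fun A B hA hB => by
    rw [mk_prod, lift_id, lift_id]
    exact (mul_le_mul' hA hB).trans (mul_eq_self hκ).le
  let 𝒴 : Set (Set I) := range (fun p : List G × List G => {a | word p.1 a < word p.2 a}) ∪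
    (range (fun p : List G × I => {a | p.2 < word p.1 a}) ∪
    (range (fun p : List G × I => {a | word p.1 a = p.2}) ∪
    range (fun p : List G × 𝒳 => word p.1 ⁻¹' p.2)))
  have h𝒴 : #𝒴 ≤ κ := by
    have hadd : ∀ s t : Set (Set I), #s ≤ κ → #t ≤ κ → #(s ∪ t : Set (Set I)) ≤ κ :=
      fun s t hs ht => (mk_union_le s t).trans (add_le_of_le hκ hs ht)
    refine hadd _ _ (mk_range_le.trans (hww _ _ hw hw)) (hadd _ _
      (mk_range_le.trans (hww _ _ hw h.mk_eq.le)) (hadd _ _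
      (mk_range_le.trans (hww _ _ hw h.mk_eq.le)) (mk_range_le.trans (hww _ _ hw h𝒳))))
  obtain ⟨V, hne, htop, hV, hdec⟩ := exists_deciding_filter hwc h 𝒴 h𝒴
  have hcount : CountableInterFilter V := CardinalInterFilter.toCountableInterFilter V hwc.1
  -- As in an ultrapower: by countable completeness, a descending sequence modulo `V` would descend
  -- at a single point.
  have hwf : WellFounded fun k l : List G => ∀ᶠ a in V, word k a < word l a := by
    rw [wellFounded_iff_isEmpty_descending_chain]
    refine ⟨fun e => ?_⟩
    have h1 : ∀ᶠ a in V, ∀ n : ℕ, word (e.1 (n + 1)) a < word (e.1 n) a :=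
      eventually_countable_forall.2 e.2
    obtain ⟨a, ha⟩ := h1.exists
    exact (wellFounded_iff_isEmpty_descending_chain.1 (wellFounded_lt (α := I))).false
      ⟨fun n => word (e.1 n) a, ha⟩
  have hS : {l : List G | ∀ b, ∀ᶠ a in V, b < word l a}.Nonempty := by
    refine ⟨[], fun b => ?_⟩
    have : ∀ᶠ a in (atTop : Filter I), b < a := by
      obtain ⟨c, hc⟩ := h.exists_gt (Iic b) (h.mk_Iic_lt b)
      exact (eventually_ge_atTop c).mono fun a ha => (hc b le_rfl).trans_le ha
    exact htop this
  -- The least unbounded word plays the identity function of a normal measure: anything smaller is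
  -- bounded, hence constant by `κ`-completeness.
  obtain ⟨l, hl, hmin⟩ := hwf.has_min _ hS
  refine ⟨V.map (word l), hne.map _, ?_, inferInstance, ?_, ?_⟩
  · intro s hs
    obtain ⟨b, hb⟩ := mem_atTop_sets.1 hs
    exact (hl b).mono fun a ha => hb _ ha.le
  · intro s hs
    exact hdec _ (Or.inr (Or.inr (Or.inr ⟨(l, ⟨s, hs⟩), rfl⟩)))
  · intro g hg hlt
    have hlt' : ∀ᶠ a in V, word (⟨g, hg⟩ :: l) a < word l a := hlt
    have hnot : ¬ ∀ b, ∀ᶠ a in V, b < word (⟨g, hg⟩ :: l) a := fun h1 => hmin _ h1 hlt'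
    obtain ⟨b, hb⟩ := not_forall.1 hnot
    have hb' : ∀ᶠ a in V, ¬ b < word (⟨g, hg⟩ :: l) a :=
      (hdec _ (Or.inr (Or.inl ⟨(⟨g, hg⟩ :: l, b), rfl⟩))).resolve_left hb
    by_contra hcon
    rw [not_exists] at hcon
    have h2 : ∀ᶠ a in V, ∀ d ∈ Iic b, ¬ word (⟨g, hg⟩ :: l) a = d :=
      (eventually_cardinal_ball (h.mk_Iic_lt b)).2 fun d _ =>
        (hdec _ (Or.inr (Or.inr (Or.inl ⟨(⟨g, hg⟩ :: l, d), rfl⟩)))).resolve_left (hcon d)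
    obtain ⟨a, ha, ha'⟩ := (hb'.and h2).exists
    exact ha' _ (not_lt.1 ha) rfl

/-- Normality for functions with values in the union of a filtration. -/
theorem exists_normal_filter_of_filtration (hwc : IsWeaklyCompact κ) (h : IsInitialOrder κ I)
    {P J : Type u} (Q : I → Set P) (hQ : ∀ a, #(Q a) < κ) (f : J → I → P) (hJ : #J ≤ κ)
    (s : Set I) : ∃ V : Filter I, V.NeBot ∧ V ≤ atTop ∧ CardinalInterFilter V κ ∧
      (s ∈ V ∨ sᶜ ∈ V) ∧
      ∀ j, (∀ᶠ a in V, ∃ b < a, f j a ∈ Q b) → ∃ q, ∀ᶠ a in V, f j a = q := by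
  have hκ : ℵ₀ ≤ κ := hwc.1.le
  have hI := h.nonempty hκ
  -- The first stage containing `p` turns regressive maps into `P` into regressive maps into `I`. A
  -- constant rank leaves fewer than `κ` values.
  have hrank : ∀ p : P, ∃ i : I, ∀ b, p ∈ Q b → p ∈ Q i ∧ i ≤ b := by
    intro p
    by_cases hp : ∃ b, p ∈ Q b
    · obtain ⟨i, hi, hmin⟩ := (wellFounded_lt (α := I)).has_min {b | p ∈ Q b} hp
      exact ⟨i, fun b hb => ⟨hi, not_lt.1 (hmin b hb)⟩⟩
    · push Not at hp
      exact ⟨hI.some, fun b hb => absurd hb (hp b)⟩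
  choose i hi using hrank
  have hP : #(⋃ a, Q a) ≤ κ := (mk_iUnion_le _).trans <| by
    rw [h.mk_eq]
    exact (mul_le_mul_right (ciSup_le' fun a => (hQ a).le) κ).trans (mul_eq_self hκ).le
  let 𝒳 : Set (Set I) := range (fun p : J × (⋃ a, Q a : Set P) => {a | f p.1 a = p.2}) ∪ {s}
  have h𝒳 : #𝒳 ≤ κ := by
    refine (mk_union_le _ _).trans (add_le_of_le hκ (mk_range_le.trans ?_) ?_)
    · rw [mk_prod, lift_id, lift_id]
      exact (mul_le_mul' hJ hP).trans (mul_eq_self hκ).le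
    · rw [mk_singleton]
      exact one_le_aleph0.trans hκ
  obtain ⟨V, hne, htop, hV, hdec, hnorm⟩ := exists_normal_filter hwc h 𝒳 h𝒳
    (range fun j a => i (f j a)) (mk_range_le.trans hJ)
  refine ⟨V, hne, htop, hV, hdec s (Or.inr rfl), fun j hj => ?_⟩
  obtain ⟨b, hb⟩ := hnorm _ ⟨j, rfl⟩ (hj.mono fun a ⟨b, hba, hb⟩ => (hi _ b hb).2.trans_lt hba)
  have hb' : ∀ᶠ a in V, f j a ∈ Q b := by
    filter_upwards [hb, hj] with a ha ⟨c, _, hc⟩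
    exact ha ▸ (hi _ c hc).1
  by_contra hcon
  rw [not_exists] at hcon
  have h2 : ∀ᶠ a in V, ∀ q ∈ Q b, ¬ f j a = q :=
    (eventually_cardinal_ball (hQ b)).2 fun q hq =>
      (hdec _ (Or.inl ⟨(j, ⟨q, mem_iUnion.2 ⟨b, hq⟩⟩), rfl⟩)).resolve_left (hcon q)
  obtain ⟨a, ha, ha'⟩ := (hb'.and h2).exists
  exact ha' _ ha rfl

end Filters

/-! ### Regular suborders and the proof that weak compactness gives layering. -/

theorem Compat.symm {P : Type u} [PartialOrder P] {p q : P} (h : Compat p q) : Compat q p :=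
  let ⟨r, h1, h2⟩ := h
  ⟨r, h2, h1⟩

theorem Compat.refl {P : Type u} [PartialOrder P] (p : P) : Compat p p :=
  ⟨p, le_rfl, le_rfl⟩

/-- An antichain is maximal if every element is compatible with one of its members. -/
theorem isMaxAntichain_compat_iff {P : Type u} [PartialOrder P] {A : Set P} :
    IsMaxAntichain Compat A ↔ IsAntichain Compat A ∧ ∀ p, ∃ a ∈ A, Compat a p := by
  refine ⟨fun h => ⟨h.1, fun p => ?_⟩, fun h => ⟨h.1, fun t ht hAt => hAt.antisymm fun p hp => ?_⟩⟩
  · by_contra! hp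
    have h1 : IsAntichain Compat (insert p A) := h.1.insert
      (fun b hb _ hc => hp b hb hc) (fun b hb _ hc => hp b hb hc.symm)
    have h2 : p ∈ A := (h.2 h1 (subset_insert p A)).symm ▸ mem_insert p A
    exact hp p h2 (Compat.refl p)
  · obtain ⟨a, ha, hap⟩ := h.2 p
    by_contra hpA
    exact ht (hAt ha) hp (fun h1 => hpA (h1 ▸ ha)) hap

/-- If incompatibility is preserved, antichains of `S` remain antichains in `P`, so only maximality
can fail. -/
theorem exists_of_not_isRegularSuborder {P : Type u} [PartialOrder P] {S : Set P}
    (hS : ¬ IsRegularSuborder S) :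
    (∃ p ∈ S, ∃ q ∈ S, Compat p q ∧ ∀ r ∈ S, r ≤ p → ¬ r ≤ q) ∨
    ∃ A ⊆ S, IsAntichain Compat A ∧ (∀ p ∈ S, ∃ a ∈ A, Compat a p) ∧
      ∃ b, ∀ a ∈ A, ¬ Compat a b := by
  by_cases hinc : ∀ p q : S, ¬ Compat p q → ¬ Compat (p : P) (q : P)
  · right
    have hmax : ¬ ∀ A : Set S, IsMaxAntichain Compat A →
        IsMaxAntichain Compat ((fun q : S => (q : P)) '' A) := fun h => hS ⟨hinc, h⟩
    push Not at hmax
    obtain ⟨A, hA, hA'⟩ := hmax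
    rw [isMaxAntichain_compat_iff] at hA hA'
    have hanti : IsAntichain Compat ((fun q : S => (q : P)) '' A) := by
      rintro _ ⟨p, hp, rfl⟩ _ ⟨q, hq, rfl⟩ hne
      exact hinc p q (hA.1 hp hq fun h => hne (h ▸ rfl))
    refine ⟨_, by rintro _ ⟨p, -, rfl⟩; exact p.2, hanti, fun p hp => ?_, ?_⟩
    · obtain ⟨a, ha, r, hra, hrp⟩ := hA.2 ⟨p, hp⟩
      exact ⟨a, mem_image_of_mem _ ha, r, hra, hrp⟩
    · by_contra! hcon
      exact hA' ⟨hanti, hcon⟩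
  · left
    push Not at hinc
    obtain ⟨p, q, hpq, hpq'⟩ := hinc
    exact ⟨p, p.2, q, q.2, hpq', fun r hr h1 h2 => hpq ⟨⟨r, hr⟩, h1, h2⟩⟩

variable {κ : Cardinal.{u}}

theorem mk_biUnion_lt (hreg : κ.IsRegular) {ι P : Type u} {s : Set ι} {f : ι → Set P}
    (hs : #s < κ) (hf : ∀ i ∈ s, #(f i) < κ) : #(⋃ i ∈ s, f i) < κ := by
  rw [card_biUnion_lt_iff_forall_of_isRegular hreg hs]
  exact hf

theorem mk_insert_lt (hκ : ℵ₀ ≤ κ) {P : Type u} {s : Set P} (hs : #s < κ) (p : P) :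
    #(insert p s : Set P) < κ :=
  mk_insert_le.trans_lt (add_lt_of_lt hκ hs (one_lt_aleph0.trans_le hκ))

/-- A continuous increasing chain of members of a club, each one containing prescribed information
about the union of its predecessors. -/
theorem exists_filtration (hreg : κ.IsRegular) {P : Type u} {C : Set (Set P)}
    (hC : IsClubPKappa κ C) {I : Type u} [LinearOrder I] [WellFoundedLT I]
    (h : IsInitialOrder κ I) (e : Set P → Set P) (he : ∀ S : Set P, #S < κ → #(e S) < κ) :
    ∃ Q : I → Set P, ∀ a, Q a ∈ C ∧ (⋃ b ∈ Iio a, Q b) ⊆ Q a ∧ e (⋃ b ∈ Iio a, Q b) ⊆ Q a := by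
  have hκ : ℵ₀ ≤ κ := hreg.aleph0_le
  have hg : ∀ S : Set P, ∃ T : Set P, #S < κ → T ∈ C ∧ S ⊆ T ∧ e S ⊆ T := by
    intro S
    by_cases hS : #S < κ
    · obtain ⟨T, hT, hST⟩ := hC.cofinal (S ∪ e S)
        ((mk_union_le _ _).trans_lt (add_lt_of_lt hκ hS (he S hS)))
      exact ⟨T, fun _ => ⟨hT, union_subset_iff.1 hST⟩⟩
    · exact ⟨∅, fun h1 => absurd h1 hS⟩
  choose g hg using hg
  let Q : I → Set P := (wellFounded_lt (α := I)).fix fun a Q => g (⋃ b : Iio a, Q b.1 b.2)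
  have hQ : ∀ a, Q a = g (⋃ b ∈ Iio a, Q b) := by
    intro a
    rw [biUnion_eq_iUnion]
    exact (wellFounded_lt (α := I)).fix_eq _ a
  have hmem : ∀ a, Q a ∈ C := by
    intro a
    induction a using WellFoundedLT.induction with
    | ind a ih =>
      rw [hQ]
      exact (hg _ (mk_biUnion_lt hreg
        ((mk_le_mk_of_subset Iio_subset_Iic_self).trans_lt (h.mk_Iic_lt a))
        fun b hb => hC.subset (ih b hb))).1
  refine ⟨Q, fun a => ⟨hmem a, ?_⟩⟩
  have := hg (⋃ b ∈ Iio a, Q b) (mk_biUnion_lt hreg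
        ((mk_le_mk_of_subset Iio_subset_Iic_self).trans_lt (h.mk_Iic_lt a))
        fun b _ => hC.subset (hmem b))
  rw [← hQ] at this
  exact this.2

theorem stationarilyLayered_of_isWeaklyCompact (hreg : κ.IsRegular) (hwc : IsWeaklyCompact κ)
    (P : Type u) [PartialOrder P] (hcc : ChainCondition κ P) : StationarilyLayered κ P := by
  have hκ : ℵ₀ ≤ κ := hreg.aleph0_le
  refine ⟨fun Q hQ => hQ.1, fun C hC => ?_⟩
  by_contra hne
  have hbad : ∀ S ∈ C, ¬ IsRegularSuborder S := fun S hS hr =>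
    hne ⟨S, ⟨hC.subset hS, hr⟩, hS⟩
  obtain ⟨p₀⟩ : Nonempty P := by
    by_contra hP
    rw [not_nonempty_iff] at hP
    obtain ⟨S, hS, -⟩ := hC.cofinal ∅ (by simpa [PKappa] using hreg.pos)
    refine hbad S hS ⟨fun p => hP.elim p, fun A hA => ?_⟩
    exact isMaxAntichain_compat_iff.2 ⟨fun p => hP.elim p, fun p => hP.elim p⟩
  have hw : ∀ p q : P, ∃ r, Compat p q → r ≤ p ∧ r ≤ q := fun p q => by
    by_cases h : Compat p q
    · obtain ⟨r, hr⟩ := h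
      exact ⟨r, fun _ => hr⟩
    · exact ⟨p₀, fun h1 => absurd h1 h⟩
  choose w hw using hw
  let Incomp : Set P → Prop := fun S => ∃ p ∈ S, ∃ q ∈ S, Compat p q ∧ ∀ r ∈ S, r ≤ p → ¬ r ≤ q
  have hpq : ∀ S : Set P, ∃ p q, Incomp S →
      p ∈ S ∧ q ∈ S ∧ Compat p q ∧ ∀ r ∈ S, r ≤ p → ¬ r ≤ q := fun S => by
    by_cases h : Incomp S
    · obtain ⟨p, hp, q, hq, h1⟩ := h
      exact ⟨p, q, fun _ => ⟨hp, hq, h1⟩⟩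
    · exact ⟨p₀, p₀, fun h1 => absurd h1 h⟩
  choose p q hpq using hpq
  have hA : ∀ S : Set P, ∃ (A : Set P) (b : P) (m : P → P), S ∈ C → ¬ Incomp S →
      A ⊆ S ∧ IsAntichain Compat A ∧ (∀ x ∈ S, m x ∈ A ∧ Compat (m x) x) ∧
        ∀ a ∈ A, ¬ Compat a b := fun S => by
    by_cases h : S ∈ C ∧ ¬ Incomp S
    · obtain ⟨A, hAS, hA, hm, b, hb⟩ :=
        (exists_of_not_isRegularSuborder (hbad S h.1)).resolve_left h.2
      choose! m hm using hm
      exact ⟨A, b, m, fun _ _ => ⟨hAS, hA, hm, hb⟩⟩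
    · exact ⟨∅, p₀, id, fun h1 h2 => absurd ⟨h1, h2⟩ h⟩
  choose A b m hA using hA
  let I := κ.ord.ToType
  have h : IsInitialOrder κ I := isInitialOrder_toType hreg
  have hI := h.nonempty hκ
  obtain ⟨Q, hQ⟩ := exists_filtration hreg hC h
    (fun S => insert (b S) (image2 w S S)) fun S hS =>
      mk_insert_lt hκ (by
        rw [← image_uncurry_prod]
        refine mk_image_le.trans_lt ?_
        rw [mk_setProd]
        exact mul_lt_of_lt hκ hS hS) _
  let R : I → Set P := fun a => ⋃ b ∈ Iio a, Q b
  have hQR : ∀ {a b}, a < b → Q a ⊆ R b := fun hab => subset_biUnion_of_mem (u := Q) hab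
  have hmono : Monotone Q := fun a b hab => by
    rcases hab.eq_or_lt with rfl | hab
    · exact le_rfl
    · exact (hQR hab).trans (hQ b).2.1
  have hRC : ∀ a b, a < b → R b ∈ C := by
    intro a b hab
    have : R b = ⋃₀ (Q '' Iio b) := (sUnion_image Q (Iio b)).symm
    rw [this]
    refine hC.closed _ (by rintro _ ⟨c, -, rfl⟩; exact (hQ c).1) ⟨_, mem_image_of_mem Q hab⟩ ?_
      (mk_image_le.trans_lt
        ((mk_le_mk_of_subset Iio_subset_Iic_self).trans_lt (h.mk_Iic_lt b)))
    rintro _ ⟨c, -, rfl⟩ _ ⟨d, -, rfl⟩ -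
    exact (le_total c d).imp (fun h => hmono h) (fun h => hmono h)
  have hP' : #(⋃ a, Q a) ≤ κ := (mk_iUnion_le _).trans <| by
    rw [h.mk_eq]
    exact (mul_le_mul_right (ciSup_le' fun a => (hC.subset (hQ a).1).le) κ).trans
      (mul_eq_self hκ).le
  -- The maps to be made constant: both coordinates of the bad pair and, for each `x`, the member of
  -- `A (R a)` compatible with `x`.
  let f : Option (Option (⋃ a, Q a : Set P)) → I → P := fun j a =>
    match j with
    | none => p (R a)
    | some none => q (R a)
    | some (some x) => m (R a) x
  obtain ⟨V, hne, htop, hV, hdec, hnorm⟩ := exists_normal_filter_of_filtration hwc h Q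
    (fun a => hC.subset (hQ a).1) f
    (by
      rw [mk_option, mk_option]
      have h1 : (1 : Cardinal.{u}) ≤ κ := one_le_aleph0.trans hκ
      exact add_le_of_le hκ (add_le_of_le hκ hP' h1) h1)
    {a | Incomp (R a)}
  have hgt : ∀ c, ∀ᶠ a in V, c < a := fun c => by
    obtain ⟨d, hd⟩ := h.exists_gt (Iic c) (h.mk_Iic_lt c)
    exact htop ((eventually_ge_atTop d).mono fun a ha => (hd c self_mem_Iic).trans_le ha)
  have hR : ∀ {a x}, x ∈ R a ↔ ∃ b < a, x ∈ Q b := by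
    intro a x
    simp [R]
  rcases hdec with hinc | hinc
  · obtain ⟨x, hx⟩ := hnorm none (mem_of_superset hinc fun a ha => hR.1 (hpq _ ha).1)
    obtain ⟨y, hy⟩ := hnorm (some none) (mem_of_superset hinc fun a ha => hR.1 (hpq _ ha).2.1)
    have hall : ∀ᶠ a in V, x ∈ R a ∧ y ∈ R a ∧ Compat x y ∧ ∀ r ∈ R a, r ≤ x → ¬ r ≤ y := by
      filter_upwards [hx, hy, hinc] with a hax hay ha
      have := hpq _ ha
      rwa [show p (R a) = x from hax, show q (R a) = y from hay] at this
    obtain ⟨a, ha⟩ := hall.exists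
    -- The pair is the same at `a` and at a later `c`, but `w x y` entered at stage `a`.
    obtain ⟨c, hc, hac⟩ := (hall.and (hgt a)).exists
    have hwxy := hw x y ha.2.2.1
    exact hc.2.2.2 _ (hQR hac ((hQ a).2.2 (Or.inr (mem_image2_of_mem ha.1 ha.2.1)))) hwxy.1 hwxy.2
  · have hAa : ∀ᶠ a in V, A (R a) ⊆ R a ∧ IsAntichain Compat (A (R a)) ∧
        (∀ x ∈ R a, m (R a) x ∈ A (R a) ∧ Compat (m (R a) x) x) ∧
        ∀ x ∈ A (R a), ¬ Compat x (b (R a)) := by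
      filter_upwards [hinc, hgt hI.some] with a ha hgt
      exact hA _ (hRC _ _ hgt) ha
    let B : Set P := {x | ∀ᶠ a in V, x ∈ A (R a)}
    have hB : IsAntichain Compat B := fun x hx y hy hxy => by
      obtain ⟨a, hax, hay, ha⟩ := (hx.and (hy.and hAa)).exists
      exact ha.2.1 hax hay hxy
    have hBA : ∀ᶠ a in V, ∀ x ∈ B, x ∈ A (R a) :=
      (eventually_cardinal_ball (hcc B hB)).2 fun x hx => hx
    obtain ⟨a, hBa, haa⟩ := (hBA.and hAa).exists
    have hba : b (R a) ∈ Q a := (hQ a).2.2 (mem_insert _ _)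
    have hm : ∀ᶠ c in V, m (R c) (b (R a)) ∈ A (R c) ∧ Compat (m (R c) (b (R a))) (b (R a)) ∧
        A (R c) ⊆ R c := by
      filter_upwards [hAa, hgt a] with c hc hac
      exact ⟨(hc.2.2.1 _ (hQR hac hba)).1, (hc.2.2.1 _ (hQR hac hba)).2, hc.1⟩
    obtain ⟨x, hx⟩ := hnorm (some (some ⟨b (R a), mem_iUnion.2 ⟨a, hba⟩⟩))
      (hm.mono fun c hc => hR.1 (hc.2.2 hc.1))
    have hx' : ∀ᶠ c in V, x ∈ A (R c) ∧ Compat x (b (R a)) := by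
      filter_upwards [hm, hx] with c hc hxc
      rw [show m (R c) (b (R a)) = x from hxc] at hc
      exact ⟨hc.1, hc.2.1⟩
    obtain ⟨c, hc⟩ := hx'.exists
    exact haa.2.2.2 x (hBa x (hx'.mono fun c hc => hc.1)) hc.2

/-! ### The Erdős–Rado tree. -/

section Tree

/-- The Erdős–Rado tree order of a colouring `c`: `a` lies below `b` if `a < b` and `c` does not
distinguish `a` from `b` over the predecessors of `a`. -/
def TreeLT {I : Type u} [LinearOrder I] [WellFoundedLT I] (c : Sym2 I → Bool) (a b : I) : Prop :=
  ∃ _ : a < b, ∀ d, TreeLT c d a → c s(d, a) = c s(d, b)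
termination_by (wellFounded_lt (α := I)).wrap b
decreasing_by assumption

variable {I : Type u} [LinearOrder I] [WellFoundedLT I] {c : Sym2 I → Bool}

theorem treeLT_iff {a b : I} :
    TreeLT c a b ↔ a < b ∧ ∀ d, TreeLT c d a → c s(d, a) = c s(d, b) := by
  rw [TreeLT, exists_prop]

theorem TreeLT.lt {a b : I} (h : TreeLT c a b) : a < b :=
  (treeLT_iff.1 h).1

theorem TreeLT.color_eq {d a b : I} (h : TreeLT c a b) (hd : TreeLT c d a) :
    c s(d, a) = c s(d, b) :=
  (treeLT_iff.1 h).2 d hd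

theorem TreeLT.trans {a b d : I} (hab : TreeLT c a b) (hbd : TreeLT c b d) : TreeLT c a d := by
  induction b using WellFoundedLT.induction generalizing a d with
  | ind b ih =>
    refine treeLT_iff.2 ⟨hab.lt.trans hbd.lt, fun e he => ?_⟩
    rw [hab.color_eq he, hbd.color_eq (ih a hab.lt he hab)]

theorem TreeLT.of_lt {a b d : I} (ha : TreeLT c a d) (hb : TreeLT c b d) (hab : a < b) :
    TreeLT c a b := by
  induction a using WellFoundedLT.induction with
  | ind a ih =>
    refine treeLT_iff.2 ⟨hab, fun e he => ?_⟩
    rw [ha.color_eq he, hb.color_eq (ih e he.lt (he.trans ha) (he.lt.trans hab))]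

/-- If `a` has a successor towards `l` below `l`, then the predecessors of `l` do not end
with `a`. -/
theorem TreeLT.exists_between {a b l : I} (hal : TreeLT c a l) (hab : TreeLT c a b)
    (hbl : b < l) (hc : c s(a, b) = c s(a, l)) : ∃ e, TreeLT c a e ∧ TreeLT c e l := by
  -- By minimality no predecessor of `e` lies strictly above `a`, so only colours at `a` and below
  -- need comparing.
  obtain ⟨e, ⟨hae, hce⟩, hmin⟩ := (wellFounded_lt (α := I)).has_min
    {b | TreeLT c a b ∧ c s(a, b) = c s(a, l)} ⟨b, hab, hc⟩
  have hel : e < l := (not_lt.1 (hmin b ⟨hab, hc⟩)).trans_lt hbl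
  refine ⟨e, hae, treeLT_iff.2 ⟨hel, fun d hde => ?_⟩⟩
  rcases lt_trichotomy d a with hda | rfl | hda
  · have h1 := hde.of_lt hae hda
    rw [← hae.color_eq h1, hal.color_eq h1]
  · exact hce
  · have h1 := hae.of_lt hde hda
    exact absurd hde.lt (hmin d ⟨h1, (hde.color_eq h1).trans hce⟩)

/-- Elements outside the predecessors of `l` split off from them properly below `l`. -/
theorem exists_treeLT_not_treeLT {v l : I} (hvl : v < l) (hv : ¬ TreeLT c v l)
    (hlim : ∀ a, TreeLT c a l → ∃ e, TreeLT c a e ∧ TreeLT c e l) :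
    ∃ u, TreeLT c u l ∧ ∀ u', TreeLT c u' l → u ≤ u' → ¬ TreeLT c u' v := by
  have h1 : {d | TreeLT c d v ∧ c s(d, v) ≠ c s(d, l)}.Nonempty := by
    by_contra! hcon
    refine hv (treeLT_iff.2 ⟨hvl, fun d hd => ?_⟩)
    by_contra hne
    exact (Set.ext_iff.1 hcon d).1 ⟨hd, hne⟩
  -- At the first disagreement `d` the branches to `v` and `l` part; any predecessor of `l` beyond
  -- `d` is off the branch of `v`.
  obtain ⟨d, ⟨hdv, hne⟩, hmin⟩ := (wellFounded_lt (α := I)).has_min _ h1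
  have hdl : TreeLT c d l := by
    refine treeLT_iff.2 ⟨hdv.lt.trans hvl, fun e he => ?_⟩
    rw [hdv.color_eq he]
    by_contra hne'
    exact hmin e ⟨he.trans hdv, hne'⟩ he.lt
  obtain ⟨u, hdu, hul⟩ := hlim d hdl
  refine ⟨u, hul, fun u' hu'l huu' hu'v => hne ?_⟩
  have hdu' : TreeLT c d u' := hdl.of_lt hu'l (hdu.lt.trans_le huu')
  rw [← hu'v.color_eq hdu', hu'l.color_eq hdu']

end Tree

/-! ### Finite antichains of a tree and their chain condition. -/

/-- The finite antichains of the relation `r`, ordered by reverse inclusion. -/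
@[ext]
structure FinAntichain {I : Type u} (r : I → I → Prop) : Type u where
  carrier : Finset I
  not_rel : ∀ x ∈ carrier, ∀ y ∈ carrier, ¬ r x y

namespace FinAntichain

variable {I : Type u} {r : I → I → Prop}

instance : PartialOrder (FinAntichain r) where
  le p q := q.1 ⊆ p.1
  le_refl _ := subset_rfl
  le_trans _ _ _ h1 h2 := h2.trans h1
  le_antisymm _ _ h1 h2 := FinAntichain.ext (h2.antisymm h1)

theorem carrier_injective : Function.Injective (carrier : FinAntichain r → Finset I) :=
  fun _ _ => FinAntichain.ext

theorem compat_iff {p q : FinAntichain r} :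
    Compat p q ↔ ∀ x ∈ p.1, ∀ y ∈ q.1, ¬ r x y ∧ ¬ r y x := by
  classical
  constructor
  · rintro ⟨s, hsp, hsq⟩ x hx y hy
    exact ⟨s.2 x (hsp hx) y (hsq hy), s.2 y (hsq hy) x (hsp hx)⟩
  · intro h
    refine ⟨⟨p.1 ∪ q.1, fun x hx y hy => ?_⟩, Finset.subset_union_left, Finset.subset_union_right⟩
    rcases Finset.mem_union.1 hx with hx | hx <;> rcases Finset.mem_union.1 hy with hy | hy
    · exact p.2 x hx y hy
    · exact (h x hx y hy).1
    · exact (h y hy x hx).2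
    · exact q.2 x hx y hy

end FinAntichain

section ChainCondition

variable {κ : Cardinal.{u}} {I : Type u} [LinearOrder I] {r : I → I → Prop}

/-- Baumgartner's argument: if `r` is a tree order without chains of size `κ`, then among `κ` many
finite antichains of the same size there are two whose union is an antichain. -/
theorem exists_compatible_pair (hreg : κ.IsRegular) (h : IsInitialOrder κ I)
    (hlt : ∀ a b, r a b → a < b) (htree : ∀ a b d, r a d → r b d → a < b → r a b)
    (hchain : ∀ B : Set I, (∀ a ∈ B, ∀ b ∈ B, a < b → r a b) → #B ≠ κ) (n : ℕ)
    (p : I → Finset I) (hcard : ∀ a, (p a).card = n) (hp : ∀ a, ∀ x ∈ p a, ∀ y ∈ p a, ¬ r x y) :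
    ∃ a b, a ≠ b ∧ ∀ x ∈ p a, ∀ y ∈ p b, ¬ r x y ∧ ¬ r y x := by
  classical
  induction n generalizing p with
  | zero =>
    have h1 : 1 < #I := h.mk_eq ▸ one_lt_aleph0.trans_le hreg.aleph0_le
    obtain ⟨a, b, hab⟩ := one_lt_iff_nontrivial.1 h1
    exact ⟨a, b, hab, fun x hx => by simp [Finset.card_eq_zero.1 (hcard a)] at hx⟩
  | succ n ih =>
    -- A point common to `κ` many sets can be removed, reducing `n`. Otherwise the sets eventually
    -- lie above any given point.
    by_cases hx : ∃ x, #{a | x ∈ p a} = κ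
    · obtain ⟨x, hx⟩ := hx
      obtain ⟨e⟩ := Cardinal.eq.1 (h.mk_eq.trans hx.symm)
      obtain ⟨a, b, hab, hc⟩ := ih (fun a => (p (e a)).erase x)
        (fun a => by rw [Finset.card_erase_of_mem (e a).2, hcard, Nat.add_sub_cancel])
        (fun a y hy z hz => hp _ y (Finset.mem_of_mem_erase hy) z (Finset.mem_of_mem_erase hz))
      refine ⟨e a, e b, fun hab' => hab (e.injective (Subtype.ext hab')), fun y hy z hz => ?_⟩
      have hxa : x ∈ p (e a) := (e a).2
      have hxb : x ∈ p (e b) := (e b).2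
      by_cases hyx : y = x
      · subst hyx
        exact ⟨hp _ y hxb z hz, hp _ z hz y hxb⟩
      · by_cases hzx : z = x
        · subst hzx
          exact ⟨hp _ y hy z hxa, hp _ z hxa y hy⟩
        · exact hc y (Finset.mem_erase.2 ⟨hyx, hy⟩) z (Finset.mem_erase.2 ⟨hzx, hz⟩)
    · have hlt_κ : ∀ s : Set I, #s ≠ κ → #s < κ :=
        fun s hs => lt_of_le_of_ne (h.mk_eq ▸ mk_set_le s) hs
      have hsmall : ∀ x, ∃ d, ∀ b, (∃ y ∈ p b, y ≤ x) → b < d := fun x => by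
        obtain ⟨d, hd⟩ := h.exists_gt (⋃ y ∈ Iic x, {a | y ∈ p a})
          (mk_biUnion_lt hreg (h.mk_Iic_lt x) fun y _ => hlt_κ _ fun hy => hx ⟨y, hy⟩)
        exact ⟨d, fun b ⟨y, hy, hyx⟩ => hd b (mem_iUnion₂.2 ⟨y, hyx, hy⟩)⟩
      have hI := h.nonempty hreg.aleph0_le
      by_contra! hcon
      let W : Ultrafilter I := Ultrafilter.of atTop
      have hW : ∀ d, ∀ᶠ b in (W : Filter I), d ≤ b := fun d => Ultrafilter.of_le atTop (eventually_ge_atTop d)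
      have hW' : ∀ x, ∀ᶠ b in (W : Filter I), ∀ y ∈ p b, x < y := fun x => by
        obtain ⟨d, hd⟩ := hsmall x
        filter_upwards [hW d] with b hb y hy
        by_contra! hyx
        exact (hd b ⟨y, hy, hyx⟩).not_ge hb
      let e : ∀ b, Fin (n + 1) ≃ p b := fun b => ((p b).equivFinOfCardEq (hcard b)).symm
      -- There are finitely many pairs `(x, j)`, so the ultrafilter selects one.
      have hex : ∀ a, ∃ x ∈ p a, ∃ j, ∀ᶠ b in W, r x (e b j) := by
        intro a
        have h1 : ∀ᶠ b in W, ∃ x ∈ p a, ∃ j, r x (e b j) := by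
          have h2 : ∀ᶠ b in W, ∀ x ∈ p a, ∀ y ∈ p b, x < y :=
            (Finset.eventually_all (p a)).2 fun x _ => hW' x
          have h3 : ∀ᶠ b in W, a ≠ b := by
            obtain ⟨d, hd⟩ := h.exists_gt (Iic a) (h.mk_Iic_lt a)
            exact (hW d).mono fun b hb => ((hd a self_mem_Iic).trans_le hb).ne
          filter_upwards [h2, h3] with b hb hab
          obtain ⟨x, hx, y, hy, hxy⟩ := hcon a b hab
          refine ⟨x, hx, (e b).symm ⟨y, hy⟩, ?_⟩
          rw [Equiv.apply_symm_apply]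
          by_contra hrxy
          exact (hlt _ _ (hxy hrxy)).not_gt (hb x hx y hy)
        by_contra! hno
        have h4 : ∀ᶠ b in W, ∀ x ∈ p a, ∀ j, ¬ r x (e b j) :=
          (Finset.eventually_all (p a)).2 fun x hx =>
            eventually_all.2 fun j => hno x hx j
        obtain ⟨b, ⟨x, hx, j, hxj⟩, hb⟩ := (h1.and h4).exists
        exact hb x hx j hxj
      -- Each `B j` is a chain, since two members share an upper bound in the tree; hence it is
      -- bounded. Some `p g` lies above all these bounds, yet meets some `B j`.
      let B : Fin (n + 1) → Set I := fun j => {x | ∀ᶠ b in W, r x (e b j)}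
      have hB : ∀ j, ∃ d, ∀ x ∈ B j, x < d := fun j =>
        h.exists_gt _ <| hlt_κ _ <| hchain _ fun x hx y hy hxy => by
          obtain ⟨b, hb, hb'⟩ := (Filter.Eventually.and hx hy).exists
          exact htree x y _ hb hb' hxy
      choose d hd using hB
      obtain ⟨D, hD⟩ := (finite_range d).bddAbove
      obtain ⟨g, hg⟩ := hsmall D
      obtain ⟨x, hxg, j, hj⟩ := hex g
      exact (hg g ⟨x, hxg, (hd j x hj).le.trans (hD (mem_range_self j))⟩).false

theorem chainCondition_finAntichain (hreg : κ.IsRegular) (hunc : ℵ₀ < κ) (h : IsInitialOrder κ I)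
    (hlt : ∀ a b, r a b → a < b) (htree : ∀ a b d, r a d → r b d → a < b → r a b)
    (hchain : ∀ B : Set I, (∀ a ∈ B, ∀ b ∈ B, a < b → r a b) → #B ≠ κ) :
    ChainCondition κ (FinAntichain r) := by
  intro A hA
  have hcover : A = ⋃ n ∈ (univ : Set (ULift.{u} ℕ)), {p ∈ A | p.1.card = n.down} := by
    ext p
    simp only [mem_univ, iUnion_true, mem_iUnion, mem_ofPred_eq]
    exact ⟨fun hp => ⟨⟨p.1.card⟩, hp, rfl⟩, fun ⟨_, hp, _⟩ => hp⟩
  rw [hcover]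
  refine mk_biUnion_lt hreg (by simpa using hunc) fun n _ => ?_
  by_contra! hge
  rw [← h.mk_eq] at hge
  obtain ⟨e⟩ := hge
  obtain ⟨a, b, hab, hc⟩ := exists_compatible_pair hreg h hlt htree hchain n.down
    (fun a => (e a).1.1) (fun a => (e a).2.2) (fun a => (e a).1.2)
  exact hA (e a).2.1 (e b).2.1 (fun h1 => hab (e.injective (Subtype.ext h1)))
    (FinAntichain.compat_iff.2 hc)

end ChainCondition

/-! ### The club of supports closed under a function. -/

section Club

variable {κ : Cardinal.{u}} {I : Type u} [LinearOrder I] {r : I → I → Prop}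

theorem mk_finset_lt (hunc : ℵ₀ < κ) {P : Type u} {Q : Set P} (f : P → Finset I)
    (hf : Function.Injective f) {X : Set I} (hX : #X < κ) (hQ : ∀ p ∈ Q, ↑(f p) ⊆ X) : #Q < κ := by
  classical
  have h1 : #(Finset X) < κ :=
    (mk_le_of_surjective (List.toFinset_surjective (α := X))).trans_lt
      ((mk_list_le_max X).trans_lt (max_lt hunc hX))
  refine lt_of_le_of_lt ?_ h1
  refine mk_le_of_injective (f := fun p : Q => (f p).subtype (· ∈ X)) fun p q hpq => ?_
  refine Subtype.ext (hf ?_)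
  have := congrArg (Finset.map (Function.Embedding.subtype _)) hpq
  simp only [Finset.subtype_map] at this
  rwa [Finset.filter_true_of_mem fun x hx => hQ p p.2 hx,
    Finset.filter_true_of_mem fun x hx => hQ q q.2 hx] at this

/-- Every small set is contained in a small initial segment closed under a given pair of
functions. -/
theorem exists_isLowerSet_closed (hreg : κ.IsRegular) (hunc : ℵ₀ < κ) (h : IsInitialOrder κ I)
    (f : I → Bool → I) (s : Set I) (hs : #s < κ) :
    ∃ X : Set I, IsLowerSet X ∧ X.Nonempty ∧ #X < κ ∧ s ⊆ X ∧ ∀ a ∈ X, ∀ i, f a i ∈ X := by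
  have hκ := hreg.aleph0_le
  have hg : ∀ a, ∃ b, ∀ x ≤ a, ∀ i, f x i ≤ b := fun a => by
    obtain ⟨b, hb⟩ := h.exists_gt ((fun x => f x true) '' Iic a ∪ (fun x => f x false) '' Iic a)
      ((mk_union_le _ _).trans_lt (add_lt_of_lt hκ (mk_image_le.trans_lt (h.mk_Iic_lt a))
        (mk_image_le.trans_lt (h.mk_Iic_lt a))))
    refine ⟨b, fun x hx i => (hb _ ?_).le⟩
    cases i
    · exact Or.inr ⟨x, hx, rfl⟩
    · exact Or.inl ⟨x, hx, rfl⟩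
  choose g hg using hg
  obtain ⟨a₀, ha₀⟩ := h.exists_gt s hs
  -- Closing off takes `ω` steps, which stay bounded because `κ` is regular and uncountable.
  let a : ℕ → I := fun n => g^[n] a₀
  have hsub : ∃ b, ∀ n, a n < b := by
    obtain ⟨b, hb⟩ := h.exists_gt (range a) ((countable_range a).le_aleph0.trans_lt hunc)
    exact ⟨b, fun n => hb _ (mem_range_self n)⟩
  obtain ⟨b, hb⟩ := hsub
  refine ⟨⋃ n, Iic (a n), isLowerSet_iUnion fun n => isLowerSet_Iic _,
    ⟨a 0, mem_iUnion.2 ⟨0, self_mem_Iic⟩⟩, ?_, fun x hx => ?_, fun x hx i => ?_⟩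
  · refine (mk_le_mk_of_subset (iUnion_subset fun n => ?_)).trans_lt (h.mk_Iic_lt b)
    exact Iic_subset_Iic.2 (hb n).le
  · exact mem_iUnion.2 ⟨0, (ha₀ x hx).le⟩
  · obtain ⟨n, hn⟩ := mem_iUnion.1 hx
    refine mem_iUnion.2 ⟨n + 1, ?_⟩
    have : a (n + 1) = g (a n) := Function.iterate_succ_apply' g n a₀
    rw [mem_Iic, this]
    exact hg _ x hn i

/-- The conditions supported by small initial segments which are closed under `f` form a club. -/
theorem isClubPKappa_finAntichain (hreg : κ.IsRegular) (hunc : ℵ₀ < κ) (h : IsInitialOrder κ I)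
    (hirr : ∀ a, ¬ r a a) (f : I → Bool → I) :
    IsClubPKappa κ {Q : Set (FinAntichain r) | ∃ X : Set I, IsLowerSet X ∧ X.Nonempty ∧ #X < κ ∧
      (∀ a ∈ X, ∀ i, f a i ∈ X) ∧ Q = {p | ↑p.1 ⊆ X}} where
  subset := by
    rintro _ ⟨X, -, -, hX, -, rfl⟩
    exact mk_finset_lt hunc FinAntichain.carrier FinAntichain.carrier_injective hX fun p hp => hp
  cofinal a ha := by
    obtain ⟨X, hlow, hne, hX, haX, hf⟩ := exists_isLowerSet_closed hreg hunc h f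
      (⋃ p ∈ a, (p.1 : Set I)) (mk_biUnion_lt hreg ha fun p _ =>
        (p.1.finite_toSet.lt_aleph0).trans hunc)
    exact ⟨_, ⟨X, hlow, hne, hX, hf, rfl⟩, fun p hp => (subset_biUnion_of_mem
      (u := fun p : FinAntichain r => (p.1 : Set I)) hp).trans haX⟩
  closed D hD hne hchain hcard := by
    have hD' : ∀ Q ∈ D, ∃ X : Set I, IsLowerSet X ∧ X.Nonempty ∧ #X < κ ∧
      (∀ a ∈ X, ∀ i, f a i ∈ X) ∧ Q = {p | ↑p.1 ⊆ X} := fun Q hQ => hD hQ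
    choose! X hlow hXne hX hf hQ using hD'
    have hmono : ∀ Q ∈ D, ∀ Q' ∈ D, Q ⊆ Q' → X Q ⊆ X Q' := by
      intro Q hQD Q' hQD' hsub x hx
      -- Singletons recover the support from its set of conditions.
      let p : FinAntichain r := ⟨{x}, by simpa using hirr x⟩
      have hp : p ∈ Q := by
        rw [hQ Q hQD]
        simpa [p] using hx
      have hp' := hsub hp
      rw [hQ Q' hQD'] at hp'
      simpa [p] using hp'
    refine ⟨⋃ Q ∈ D, X Q, isLowerSet_iUnion₂ hlow, ?_, mk_biUnion_lt hreg hcard hX,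
      fun a ha i => ?_, ?_⟩
    · obtain ⟨Q, hQD⟩ := hne
      obtain ⟨x, hx⟩ := hXne Q hQD
      exact ⟨x, mem_iUnion₂.2 ⟨Q, hQD, hx⟩⟩
    · obtain ⟨Q, hQD, ha⟩ := mem_iUnion₂.1 ha
      exact mem_iUnion₂.2 ⟨Q, hQD, hf Q hQD a ha i⟩
    · ext p
      rw [mem_sUnion, mem_ofPred_eq]
      constructor
      · rintro ⟨Q, hQD, hp⟩
        rw [hQ Q hQD] at hp
        exact hp.trans (subset_biUnion_of_mem (u := X) hQD)
      · intro hp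
        have hdir : DirectedOn (fun Q Q' => X Q ⊆ X Q') D := fun Q hQD Q' hQD' => by
          rcases hchain.total hQD hQD' with h1 | h1
          · exact ⟨Q', hQD', hmono Q hQD Q' hQD' h1, subset_rfl⟩
          · exact ⟨Q, hQD, subset_rfl, hmono Q' hQD' Q hQD h1⟩
        obtain ⟨Q, hQD, hpQ⟩ := DirectedOn.exists_mem_subset_of_finset_subset_biUnion hne hdir hp
        exact ⟨Q, hQD, by rw [hQ Q hQD]; exact hpQ⟩

end Club

/-! ### Layering gives weak compactness. -/

theorem not_isRegularSuborder_Iio {I : Type u} [LinearOrder I] [WellFoundedLT I]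
    {c : Sym2 I → Bool} {l : I} (hl : ∃ a, a < l)
    (hlim : ∀ a, TreeLT c a l → ∃ e, TreeLT c a e ∧ TreeLT c e l) :
    ¬ IsRegularSuborder {p : FinAntichain (TreeLT c) | ↑p.1 ⊆ Iio l} := by
  intro hreg
  let sing : I → FinAntichain (TreeLT c) := fun u => ⟨{u}, by simpa using fun h => h.lt.false⟩
  let A : Set {p : FinAntichain (TreeLT c) | ↑p.1 ⊆ Iio l} := {p | ∃ u, TreeLT c u l ∧ p.1 = sing u}
  have hsing : ∀ u, u < l → sing u ∈ {p : FinAntichain (TreeLT c) | ↑p.1 ⊆ Iio l} := by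
    intro u hu x hx
    rwa [Finset.mem_singleton.1 hx]
  obtain ⟨u₀, hu₀⟩ : ∃ u, TreeLT c u l := by
    obtain ⟨a, ha⟩ := hl
    -- With no predecessors the limit hypothesis is vacuous, and splitting itself produces one.
    by_contra! hcon
    obtain ⟨u, hu, -⟩ := exists_treeLT_not_treeLT ha (hcon a) fun b hb => absurd hb (hcon b)
    exact hcon u hu
  have hA : IsMaxAntichain Compat A := by
    rw [isMaxAntichain_compat_iff]
    refine ⟨?_, fun q => ?_⟩
    · rintro p ⟨u, hu, hpu⟩ p' ⟨u', hu', hpu'⟩ hne ⟨s, hs, hs'⟩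
      have h1 : u ∈ s.1.1 := hs (by rw [hpu]; exact Finset.mem_singleton_self u)
      have h2 : u' ∈ s.1.1 := hs' (by rw [hpu']; exact Finset.mem_singleton_self u')
      rcases lt_trichotomy u u' with h3 | rfl | h3
      · exact s.1.2 _ h1 _ h2 (hu.of_lt hu' h3)
      · exact hne (Subtype.ext (hpu.trans hpu'.symm))
      · exact s.1.2 _ h2 _ h1 (hu'.of_lt hu h3)
    · by_cases hq : ∃ u ∈ q.1.1, TreeLT c u l
      · obtain ⟨u, huq, hu⟩ := hq
        refine ⟨⟨sing u, hsing u hu.lt⟩, ⟨u, hu, rfl⟩, q, ?_, le_rfl⟩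
        exact Finset.singleton_subset_iff.2 huq
      · push Not at hq
        have hw : ∀ v ∈ q.1.1, ∃ u, TreeLT c u l ∧
            ∀ u', TreeLT c u' l → u ≤ u' → ¬ TreeLT c u' v := fun v hv =>
          exists_treeLT_not_treeLT (q.2 hv) (hq v hv) hlim
        choose! w hw using hw
        -- A predecessor of `l` past all finitely many splitting points; `u₀` covers empty `q`.
        obtain ⟨u, hu, hmax⟩ : ∃ u, TreeLT c u l ∧ ∀ v ∈ q.1.1, w v ≤ u := by
          classical
          obtain ⟨u, hu, hmax⟩ := Finset.exists_max_image (insert u₀ (q.1.1.image w)) id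
            ⟨u₀, Finset.mem_insert_self _ _⟩
          refine ⟨u, ?_, fun v hv => hmax _ (Finset.mem_insert_of_mem
            (Finset.mem_image_of_mem w hv))⟩
          rcases Finset.mem_insert.1 hu with rfl | hu
          · exact hu₀
          · obtain ⟨v, hv, rfl⟩ := Finset.mem_image.1 hu
            exact (hw v hv).1
        have hcomp : Compat (sing u) q.1 := by
          refine FinAntichain.compat_iff.2 fun x hx v hv => ?_
          rw [Finset.mem_singleton.1 hx]
          exact ⟨(hw v hv).2 u hu (hmax v hv), fun hvu => hq v hv (hvu.trans hu)⟩
        let a : {p : FinAntichain (TreeLT c) | ↑p.1 ⊆ Iio l} :=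
          ⟨sing u, hsing u hu.lt⟩
        exact ⟨a, ⟨u, hu, rfl⟩, by_contra fun hn => hreg.incompat a q hn hcomp⟩
  obtain ⟨_, ⟨p, ⟨u, hu, hpu⟩, rfl⟩, hp⟩ :=
    (isMaxAntichain_compat_iff.1 (hreg.maxAntichain A hA)).2 (sing l)
  replace hp : Compat p.1 (sing l) := hp
  rw [hpu] at hp
  exact (FinAntichain.compat_iff.1 hp u (Finset.mem_singleton_self u) l
    (Finset.mem_singleton_self l)).1 hu

theorem exists_treeLT_chain {κ : Cardinal.{u}} (hreg : κ.IsRegular) (hunc : ℵ₀ < κ)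
    (hlay : ∀ (P : Type u) [PartialOrder P], #P ≤ κ → ChainCondition κ P → StationarilyLayered κ P)
    {I : Type u} [LinearOrder I] [WellFoundedLT I] (h : IsInitialOrder κ I) (c : Sym2 I → Bool) :
    ∃ B : Set I, #B = κ ∧ ∀ a ∈ B, ∀ b ∈ B, a < b → TreeLT c a b := by
  by_contra! hcon
  have hcc : ChainCondition κ (FinAntichain (TreeLT c)) :=
    chainCondition_finAntichain hreg hunc h (fun _ _ hab => hab.lt)
      (fun _ _ _ ha hb hab => ha.of_lt hb hab) fun B hB hcard => by
        obtain ⟨a, ha, b, hb, hab, hn⟩ := hcon B hcard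
        exact hn (hB a ha b hb hab)
  have hcard : #(FinAntichain (TreeLT c)) ≤ κ := by
    have : Infinite I := infinite_iff.2 (h.mk_eq ▸ hunc.le)
    exact (mk_le_of_injective FinAntichain.carrier_injective).trans_eq
      ((mk_finset_of_infinite I).trans h.mk_eq)
  -- A point above `a` in direction `i` where one exists, else `a`. Closure under `f` makes the `l`
  -- found below a limit.
  have hf : ∀ (a : I) (i : Bool), ∃ b, ∀ b', TreeLT c a b' → c s(a, b') = i →
      TreeLT c a b ∧ c s(a, b) = i := fun a i => by
    by_cases hex : ∃ b, TreeLT c a b ∧ c s(a, b) = i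
    · obtain ⟨b, hb⟩ := hex
      exact ⟨b, fun _ _ _ => hb⟩
    · exact ⟨a, fun b' h1 h2 => absurd ⟨b', h1, h2⟩ hex⟩
  choose f hf using hf
  obtain ⟨_, ⟨-, hQ⟩, X, hlow, ⟨a, ha⟩, hX, hfX, rfl⟩ :=
    (hlay _ hcard hcc).2 _ (isClubPKappa_finAntichain hreg hunc h (fun _ ha => ha.lt.false) f)
  obtain ⟨l, hl, hmin⟩ := (wellFounded_lt (α := I)).has_min Xᶜ (by
    rw [nonempty_compl]
    rintro rfl
    rw [mk_univ, h.mk_eq] at hX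
    exact hX.false)
  have hXl : X = Iio l := by
    ext x
    exact ⟨fun hx => lt_of_not_ge fun hlx => hl (hlow hlx hx),
      fun hx => by_contra fun hxX => hmin x hxX hx⟩
  subst hXl
  refine not_isRegularSuborder_Iio ⟨a, ha⟩ (fun b hb => ?_) hQ
  obtain ⟨h1, h2⟩ := hf b _ l hb rfl
  exact hb.exists_between h1 (hfX b hb.lt _) h2

theorem isWeaklyCompact_of_stationarilyLayered {κ : Cardinal.{u}} (hreg : κ.IsRegular)
    (hunc : ℵ₀ < κ) (hlay : ∀ (P : Type u) [PartialOrder P], #P ≤ κ →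
      ChainCondition κ P → StationarilyLayered κ P) : IsWeaklyCompact κ := by
  refine ⟨hunc, fun A hA c₀ => ?_⟩
  let I := κ.ord.ToType
  have h : IsInitialOrder κ I := isInitialOrder_toType hreg
  obtain ⟨e⟩ := Cardinal.eq.1 (h.mk_eq.trans hA.symm)
  let c : Sym2 I → Bool := fun s => c₀ (s.map e)
  obtain ⟨B, hB, hchain⟩ := exists_treeLT_chain hreg hunc hlay h c
  -- A tree chain is end-homogeneous: the colour of a pair depends only on its smaller element.
  have hcol : ∀ a ∈ B, ∃ i, ∀ b ∈ B, a < b → c s(a, b) = i := by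
    intro a ha
    obtain ⟨d, hd, had⟩ := h.exists_mem_gt hB a
    refine ⟨c s(a, d), fun b hb hab => ?_⟩
    rcases lt_trichotomy b d with hbd | rfl | hbd
    · exact (hchain b hb d hd hbd).color_eq (hchain a ha b hb hab)
    · rfl
    · exact ((hchain d hd b hb hbd).color_eq (hchain a ha d hd had)).symm
  choose! i hi using hcol
  obtain ⟨j, hj⟩ : ∃ j, #{a ∈ B | i a = j} = κ := by
    have hle : ∀ s : Set I, #s ≤ κ := fun s => h.mk_eq ▸ mk_set_le s
    by_contra! hcon
    have hlt := add_lt_of_lt hreg.aleph0_le (lt_of_le_of_ne (hle _) (hcon true))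
      (lt_of_le_of_ne (hle _) (hcon false))
    refine ((mk_le_mk_of_subset fun a ha => ?_).trans (mk_union_le _ _)).trans_lt hlt |>.ne hB
    cases hia : i a
    · exact Or.inr ⟨ha, hia⟩
    · exact Or.inl ⟨ha, hia⟩
  refine ⟨e '' {a ∈ B | i a = j}, (mk_image_eq e.injective).trans hj, j, ?_⟩
  rintro _ ⟨a, ⟨ha, hia⟩, rfl⟩ _ ⟨b, ⟨hb, hib⟩, rfl⟩ hne
  rcases lt_trichotomy a b with hab | rfl | hab
  · exact (hi a ha b hb hab).trans hia
  · exact absurd rfl hne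
  · rw [Sym2.eq_swap]
    exact (hi b hb a ha hab).trans hib

end Layered

theorem theorem1p5 (κ : Cardinal.{u}) (hreg : κ.IsRegular) (hunc : ℵ₀ < κ) :
    List.TFAE [
      Layered.IsWeaklyCompact κ,
      ∀ (P : Type u) [PartialOrder P], #P ≤ κ →
        Layered.ChainCondition κ P → Layered.StationarilyLayered κ P,
      ∀ (P : Type u) [PartialOrder P],
        Layered.ChainCondition κ P → Layered.StationarilyLayered κ P] := by
  tfae_have 1 → 3 := fun hwc P _ hcc =>
    Layered.stationarilyLayered_of_isWeaklyCompact hreg hwc P hcc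
  tfae_have 3 → 2 := fun h P _ _ hcc => h P hcc
  tfae_have 2 → 1 := fun h => Layered.isWeaklyCompact_of_stationarilyLayered hreg hunc h
  tfae_finish
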